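/- A group $G$ is a \emph{2-group} if the order of every element of $G$ is a power of $2$. For an integer $n\ge 0$ let $C_{2^n}=\{z\in\mathbb C: z^{2^n}=1\}$, and let $C_{2^\infty}=\bigcup_{n\ge 1}C_{2^n}\subset\mathbb C$ be the quasicyclic 2-group. Regard $\mathbb C$ as a subalgebra of the real algebra $\mathbb H$ of quaternions in the standard way, and let $Q_8=\{1,-1,i,-i,j,-j,k,-k\}\subset\mathbb H$. For an integer $n\ge 1$ let $Q_{2^n}$ be the subgroup of the multiplicative group of $\mathbb H$ generated by $C_{2^{n-1}}\cup Q_8$, and let $Q_{2^\infty}=\bigcup_{n\ge 1}Q_{2^n}$. **Theorem.** Let $G$ be a 2-group, finite or infinite, that has exactly one subgroup of order $2$. Then there is $n\in\{1,2,3,\dots\}\cup\{\infty\}$ such that $G$ is isomorphic to $C_{2^n}$ or to $Q_{2^n}$; here $n=\infty$ if and only if $G$ is infinite. In particular, every infinite 2-group with exactly one subgroup of order $2$ is isomorphic to $C_{2^\infty}$ or to $Q_{2^\infty}$. -/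

import Mathlib

open scoped Quaternion

namespace TwoGroups

/-- The cyclic group `C_{2^n} = {z ∈ ℂ : z^(2^n) = 1}`, as a subgroup of `ℂˣ`. -/
def cyclicFin (n : ℕ) : Subgroup ℂˣ := rootsOfUnity (2 ^ n) ℂ

/-- The quasicyclic 2-group `C_{2^∞} = ⋃ n ≥ 1, C_{2^n}`, as a subgroup of `ℂˣ`.
The join is the set-theoretic union, see `coe_quasicyclic`. -/
def quasicyclic : Subgroup ℂˣ := ⨆ n : ℕ+, cyclicFin n

/-- `C_{2^n}` for `n ∈ ℕ ∪ {∞}`. -/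
def C : ℕ∞ → Subgroup ℂˣ
  | ⊤ => quasicyclic
  | (n : ℕ) => cyclicFin n

/-- The quaternion unit `i`. -/
def qi : ℍ[ℝ] := ⟨0, 1, 0, 0⟩

/-- The quaternion unit `j`. -/
def qj : ℍ[ℝ] := ⟨0, 0, 1, 0⟩

/-- The quaternion unit `k`. -/
def qk : ℍ[ℝ] := ⟨0, 0, 0, 1⟩

/-- The set `Q₈ = {1, -1, i, -i, j, -j, k, -k}` of units of the real quaternions. -/
def Q8 : Set ℍ[ℝ]ˣ :=
  {q | (q : ℍ[ℝ]) ∈ ({1, -1, qi, -qi, qj, -qj, qk, -qk} : Set ℍ[ℝ])}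

/-- The standard embedding `a + b i ↦ a + b i` of `ℂ` into `ℍ`, on units. -/
noncomputable def complexUnits : ℂˣ →* ℍ[ℝ]ˣ :=
  Units.map (Quaternion.ofComplex : ℂ →* ℍ[ℝ])

/-- The group `Q_{2^n}` of generalized quaternions, for `n ≥ 1`: the subgroup of `ℍˣ` generated by
`C_{2^(n-1)} ∪ Q₈`. -/
noncomputable def quaternionFin (n : ℕ) : Subgroup ℍ[ℝ]ˣ :=
  Subgroup.closure (complexUnits '' (cyclicFin (n - 1) : Set ℂˣ) ∪ Q8)

/-- The infinite group of generalized quaternions `Q_{2^∞} = ⋃ n ≥ 1, Q_{2^n}`, as a subgroup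
of `ℍˣ`. The join is the set-theoretic union, see `coe_quaternionInf`. -/
noncomputable def quaternionInf : Subgroup ℍ[ℝ]ˣ := ⨆ n : ℕ+, quaternionFin n

/-- `Q_{2^n}` for `n ∈ ℕ ∪ {∞}`. -/
noncomputable def Q : ℕ∞ → Subgroup ℍ[ℝ]ˣ
  | ⊤ => quaternionInf
  | (n : ℕ) => quaternionFin n

theorem C_top : C ⊤ = quasicyclic := rfl

theorem C_coe (n : ℕ) : C n = cyclicFin n := rfl

theorem Q_top : Q ⊤ = quaternionInf := rfl

theorem Q_coe (n : ℕ) : Q n = quaternionFin n := rfl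

theorem mem_cyclicFin (n : ℕ) (z : ℂˣ) : z ∈ cyclicFin n ↔ (z : ℂ) ^ 2 ^ n = 1 :=
  mem_rootsOfUnity' _ _

theorem cyclicFin_mono : Monotone cyclicFin :=
  fun _ _ h => rootsOfUnity_le_of_dvd (pow_dvd_pow 2 h)

theorem quaternionFin_mono : Monotone quaternionFin := fun _ _ h =>
  Subgroup.closure_mono (Set.union_subset_union_left _
    (Set.image_mono (cyclicFin_mono (Nat.sub_le_sub_right h 1))))

theorem coe_quasicyclic : (quasicyclic : Set ℂˣ) = ⋃ n : ℕ+, (cyclicFin n : Set ℂˣ) :=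
  Subgroup.coe_iSup_of_directed
    (Monotone.directed_le fun _ _ h => cyclicFin_mono (PNat.coe_le_coe _ _ |>.2 h))

theorem coe_quaternionInf :
    (quaternionInf : Set ℍ[ℝ]ˣ) = ⋃ n : ℕ+, (quaternionFin n : Set ℍ[ℝ]ˣ) :=
  Subgroup.coe_iSup_of_directed
    (Monotone.directed_le fun _ _ h => quaternionFin_mono (PNat.coe_le_coe _ _ |>.2 h))

end TwoGroups

open scoped Quaternion

namespace TwoGroups

/-! Let z be the only involution. It is central, and every nontrivial element has a power equal to
z, so a homomorphism that does not kill z is injective. If G is abelian, a character into ℂˣ that is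
nontrivial at z therefore embeds G as a group of 2-power roots of unity, which is some `C n`.

Otherwise the elements of order four, that is the square roots of z, control G. The centralizer of
each of them is abelian (`commute_of_commute`), and for some such b every conjugate is b or zb
(`exists_commute_or_anticommute`). The centralizer K of this b is then an abelian subgroup of index
two, and every y outside K satisfies y² = z and inverts K. Sending y to the quaternion j extends an
embedding of K onto `C n` to an embedding of G onto `Q (n + 1)`. -/

/-! ### The unique involution -/

/-- `z` is the only element of order two of the group `G`. -/
structure IsUniqueInvolution {G : Type*} [Group G] (z : G) : Prop where
  ne_one : z ≠ 1
  mul_self : z * z = 1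
  eq_or_eq : ∀ g : G, g * g = 1 → g = 1 ∨ g = z

theorem exists_isUniqueInvolution {G : Type*} [Group G]
    (hU : ∃! H : Subgroup G, Nat.card H = 2) : ∃ z : G, IsUniqueInvolution z := by
  obtain ⟨H, hH, huniq⟩ := hU
  have key : ∀ g : G, g * g = 1 → g ≠ 1 → Subgroup.zpowers g = H := fun g hg h1 =>
    huniq _ ((Nat.card_zpowers g).trans (orderOf_eq_prime (by rw [pow_two, hg]) h1))
  have : Finite H := Nat.finite_of_card_ne_zero (by rw [hH]; norm_num)
  have : Nontrivial H := Finite.one_lt_card_iff_nontrivial.1 (by rw [hH]; norm_num)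
  obtain ⟨⟨z, hz⟩, hz1⟩ := exists_ne (1 : H)
  have hz1 : z ≠ 1 := fun h => hz1 (Subtype.ext h)
  have hzz : z * z = 1 := by
    have := pow_card_eq_one' (G := H) (x := ⟨z, hz⟩)
    rw [hH, pow_two] at this
    exact congrArg Subtype.val this
  refine ⟨z, hz1, hzz, fun g hg => ?_⟩
  by_cases h1 : g = 1
  · exact Or.inl h1
  have hmem : g ∈ Subgroup.zpowers z := by
    rw [key z hzz hz1, ← key g hg h1]
    exact Subgroup.mem_zpowers g
  obtain ⟨i, rfl⟩ := Subgroup.mem_zpowers_iff.1 hmem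
  obtain ⟨j, rfl | rfl⟩ := Int.even_or_odd' i
  · left
    rw [zpow_mul, zpow_two, hzz, one_zpow]
  · right
    rw [zpow_add, zpow_mul, zpow_two, hzz, one_zpow, one_mul, zpow_one]

namespace IsUniqueInvolution

variable {G : Type*} [Group G] {z : G}

theorem inv_eq (hz : IsUniqueInvolution z) : z⁻¹ = z :=
  inv_eq_of_mul_eq_one_left hz.mul_self

theorem comm (hz : IsUniqueInvolution z) (g : G) : g * z = z * g := by
  have h : (g * z * g⁻¹) * (g * z * g⁻¹) = 1 := by
    calc _ = g * (z * z) * g⁻¹ := by group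
      _ = 1 := by rw [hz.mul_self]; group
  rcases hz.eq_or_eq _ h with h | h
  · exact absurd (conj_eq_one_iff.1 h) hz.ne_one
  · exact mul_inv_eq_iff_eq_mul.1 h

theorem inv_eq_mul (hz : IsUniqueInvolution z) {w : G} (hw : w * w = z) : w⁻¹ = z * w := by
  rw [inv_eq_iff_mul_eq_one, ← mul_assoc, hz.comm, mul_assoc, hw, hz.mul_self]

theorem mul_ne_self (hz : IsUniqueInvolution z) (g : G) : z * g ≠ g := fun h =>
  hz.ne_one (mul_eq_right.1 h)

/-- Square g repeatedly: the last value before 1 is an involution. -/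
theorem exists_pow_eq (hz : IsUniqueInvolution z) (hG : IsPGroup 2 G) {g : G} (hg : g ≠ 1) :
    ∃ k : ℕ, g ^ 2 ^ k = z := by
  classical
  have hex := hG g
  obtain ⟨k, hk⟩ : ∃ k, Nat.find hex = k + 1 := Nat.exists_eq_succ_of_ne_zero fun h0 => by
    have := Nat.find_spec hex
    rw [h0, pow_zero, pow_one] at this
    exact hg this
  have h1 : g ^ 2 ^ (k + 1) = 1 := hk ▸ Nat.find_spec hex
  have h2 : g ^ 2 ^ k ≠ 1 := Nat.find_min hex (by omega)
  rw [pow_succ, pow_mul, pow_two] at h1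
  exact ⟨k, (hz.eq_or_eq _ h1).resolve_left h2⟩

theorem exists_pow_mul_self_eq (hz : IsUniqueInvolution z) (hG : IsPGroup 2 G) {g : G}
    (h1 : g ≠ 1) (h2 : g ≠ z) : ∃ k : ℕ, g ^ 2 ^ k * g ^ 2 ^ k = z := by
  obtain ⟨k, hk⟩ := hz.exists_pow_eq hG h1
  cases k with
  | zero => exact absurd (by simpa using hk) h2
  | succ k => exact ⟨k, by rw [← hk, ← pow_two, ← pow_mul, pow_succ]⟩

/-! ### Centralizers of elements of order four -/

theorem eq_or_eq_of_commute (hz : IsUniqueInvolution z) {b w : G} (hb : b * b = z)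
    (hw : w * w = z) (h : Commute b w) : w = b ∨ w = z * b := by
  have : (w * b⁻¹) * (w * b⁻¹) = 1 := by
    calc (w * b⁻¹) * (w * b⁻¹) = w * (b⁻¹ * w) * b⁻¹ := by group
      _ = w * (w * b⁻¹) * b⁻¹ := by rw [h.inv_left.eq]
      _ = (w * w) * (b * b)⁻¹ := by group
      _ = 1 := by rw [hw, hb, mul_inv_cancel]
  rcases hz.eq_or_eq _ this with h | h
  · exact Or.inl (mul_inv_eq_one.1 h)
  · exact Or.inr (mul_inv_eq_iff_eq_mul.1 h)

/-- On the centralizer of an element of order four, squares determine elements up to `z`. -/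
theorem eq_or_eq_of_mul_self_eq (hz : IsUniqueInvolution z) (hG : IsPGroup 2 G) {b g h : G}
    (hb : b * b = z) (hg : Commute b g) (hh : Commute b h) (hgh : g * g = h * h) :
    g = h ∨ g = z * h := by
  -- g inverts gh⁻¹. If gh⁻¹ is neither 1 nor z, it has a power of order four; that power commutes
  -- with b, so it is b or zb and commutes with g, which also inverts it: absurd.
  have hinv : g * (g * h⁻¹) * g⁻¹ = (g * h⁻¹)⁻¹ := by
    calc g * (g * h⁻¹) * g⁻¹ = (g * g) * h⁻¹ * g⁻¹ := by group
      _ = (g * h⁻¹)⁻¹ := by rw [hgh]; group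
  by_cases h1 : g * h⁻¹ = 1
  · exact Or.inl (mul_inv_eq_one.1 h1)
  by_cases h2 : g * h⁻¹ = z
  · exact Or.inr (mul_inv_eq_iff_eq_mul.1 h2)
  obtain ⟨k, hk⟩ := hz.exists_pow_mul_self_eq hG h1 h2
  have hbw : Commute b ((g * h⁻¹) ^ 2 ^ k) := (hg.mul_right hh.inv_right).pow_right _
  have hgw : g * (g * h⁻¹) ^ 2 ^ k * g⁻¹ = ((g * h⁻¹) ^ 2 ^ k)⁻¹ := by
    rw [← conj_pow, hinv, inv_pow]
  have hcomm : Commute g ((g * h⁻¹) ^ 2 ^ k) := by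
    rcases hz.eq_or_eq_of_commute hb hk hbw with h | h <;> rw [h]
    · exact hg.symm
    · exact Commute.mul_right (hz.comm g) hg.symm
  rw [hcomm.eq, mul_inv_cancel_right, hz.inv_eq_mul hk] at hgw
  exact absurd hgw.symm (hz.mul_ne_self _)

/-- Induction by squaring: h² is a power of g², so h is a power of g up to the factor z, itself a
power of g. Thus cyclic subgroups of the centralizer form a chain. -/
theorem mem_zpowers_of_pow_eq_one (hz : IsUniqueInvolution z) (hG : IsPGroup 2 G) {b : G}
    (hb : b * b = z) (k : ℕ) : ∀ {g h : G}, Commute b g → Commute b h →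
      h ^ 2 ^ (k + 1) = 1 → g ^ 2 ^ k ≠ 1 → h ∈ Subgroup.zpowers g := by
  have hzmem : ∀ {g : G}, g ≠ 1 → z ∈ Subgroup.zpowers g := fun {g} hg => by
    obtain ⟨k, hk⟩ := hz.exists_pow_eq hG hg
    exact hk ▸ Subgroup.npow_mem_zpowers g _
  induction k with
  | zero =>
    intro g h _ _ h1 h2
    rw [zero_add, pow_one, pow_two] at h1
    rw [pow_zero, pow_one] at h2
    rcases hz.eq_or_eq _ h1 with rfl | rfl
    · exact one_mem _
    · exact hzmem h2
  | succ k ih =>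
    intro g h hg hh h1 h2
    have hmem : h * h ∈ Subgroup.zpowers (g * g) := by
      refine ih (hg.mul_right hg) (hh.mul_right hh) ?_ ?_
      · rw [← pow_two, ← pow_mul, ← pow_succ', h1]
      · rwa [← pow_two, ← pow_mul, ← pow_succ']
    obtain ⟨i, hi⟩ := Subgroup.mem_zpowers_iff.1 hmem
    rw [(Commute.refl g).mul_zpow] at hi
    have hgi : g ^ i ∈ Subgroup.zpowers g := Subgroup.zpow_mem_zpowers g i
    rcases hz.eq_or_eq_of_mul_self_eq hG hb hh (hg.zpow_right i) hi.symm with h | h <;> rw [h]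
    · exact hgi
    · exact mul_mem (hzmem fun h => h2 (by rw [h, one_pow])) hgi

/-- The centralizer of an element of order four is abelian. -/
theorem commute_of_commute (hz : IsUniqueInvolution z) (hG : IsPGroup 2 G) {b g h : G}
    (hb : b * b = z) (hg : Commute b g) (hh : Commute b h) : Commute g h := by
  by_cases hg1 : g = 1
  · rw [hg1]; exact Commute.one_left h
  by_cases hh1 : h = 1
  · rw [hh1]; exact Commute.one_right g
  obtain ⟨k, hk⟩ := hz.exists_pow_eq hG hg1
  obtain ⟨l, hl⟩ := hz.exists_pow_eq hG hh1
  have aux : ∀ {x y : G} {m n : ℕ}, Commute b x → Commute b y → x ^ 2 ^ m = z → y ^ 2 ^ n = z →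
      m ≤ n → Commute y x := by
    intro x y m n hx hy hxm hyn hmn
    obtain ⟨i, rfl⟩ := Subgroup.mem_zpowers_iff.1 <|
      hz.mem_zpowers_of_pow_eq_one hG hb m hy hx
        (by rw [pow_succ, pow_mul, hxm, pow_two, hz.mul_self])
        (fun h => hz.ne_one (by
          rw [← hyn, ← Nat.sub_add_cancel hmn, pow_add, mul_comm, pow_mul, h, one_pow]))
    exact (Commute.refl y).zpow_right i
  rcases le_total k l with h | h
  · exact (aux hg hh hk hl h).symm
  · exact aux hh hg hl hk h

/-! ### A normal cyclic subgroup of order four -/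

/-- The conjugate of c has square c⁻², so it is c⁻¹ or zc⁻¹. The latter gives (ec)² = 1, so ec is
central and e commutes with c², contrary to anticommutation. -/
theorem conj_eq_inv_of_anticommute (hz : IsUniqueInvolution z) (hG : IsPGroup 2 G) {c e : G}
    (hc : (c * c) * (c * c) = z) (he : e * e = z) (hce : (c * c) * e = z * (e * (c * c))) :
    e * c * e⁻¹ = c⁻¹ := by
  have hbe : e * (c * c) * e⁻¹ = (c * c)⁻¹ := by
    rw [hz.inv_eq_mul hc, mul_inv_eq_iff_eq_mul, mul_assoc z, hce, ← mul_assoc z, hz.mul_self,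
      one_mul]
  have hsq : (e * c * e⁻¹) * (e * c * e⁻¹) = c⁻¹ * c⁻¹ := by
    calc _ = e * (c * c) * e⁻¹ := by group
      _ = c⁻¹ * c⁻¹ := by rw [hbe, mul_inv_rev]
  have hcomm : Commute (c * c) (e * c * e⁻¹) := by
    have : Commute (c * c)⁻¹ (e * c * e⁻¹) := by
      rw [mul_inv_rev, ← hsq]
      exact (Commute.refl _).mul_left (Commute.refl _)
    exact Commute.inv_left_iff.1 this
  have hcc : Commute (c * c) c⁻¹ := ((Commute.refl c).mul_left (Commute.refl c)).inv_right
  refine (hz.eq_or_eq_of_mul_self_eq hG hc hcomm hcc hsq).resolve_right fun h => ?_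
  have h1 : (e * c) * (e * c) = 1 := by
    calc (e * c) * (e * c) = (e * c * e⁻¹) * (e * e) * c := by group
      _ = z * (c⁻¹ * z) * c := by rw [h, he]; group
      _ = z * z := by rw [hz.comm]; group
      _ = 1 := hz.mul_self
  have h2 : Commute (c * c) (e * c) := by
    rcases hz.eq_or_eq _ h1 with h | h <;> rw [h]
    · exact Commute.one_right _
    · exact hz.comm _
  have h3 : Commute (c * c) e := by
    have := h2.mul_right hcc
    rwa [mul_inv_cancel_right] at this
  rw [h3.eq] at hce
  exact hz.mul_ne_self _ hce.symm

/-- Two elements of order eight cannot have squares that generate a quaternion group of order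
eight: their product would act on its three cyclic subgroups of order four as a three-cycle. -/
theorem not_anticommute_mul_self (hz : IsUniqueInvolution z) (hG : IsPGroup 2 G) {c f : G}
    (hc : (c * c) * (c * c) = z) (hf : (f * f) * (f * f) = z)
    (hcf : (c * c) * (f * f) = z * ((f * f) * (c * c))) : False := by
  have hfc : (f * f) * (c * c) = z * ((c * c) * (f * f)) := by
    rw [hcf, ← mul_assoc z, hz.mul_self, one_mul]
  have h1 := hz.conj_eq_inv_of_anticommute hG hc hf hcf
  have h2 := hz.conj_eq_inv_of_anticommute hG hf hc hfc
  obtain ⟨b, hb⟩ : ∃ b, b = c * c := ⟨_, rfl⟩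
  obtain ⟨e, he⟩ : ∃ e, e = f * f := ⟨_, rfl⟩
  have hbc : b * c = c * b := by rw [hb, mul_assoc]
  have hef : e * f = f * e := by rw [he, mul_assoc]
  rw [← hb] at hc hcf hfc h2
  rw [← he] at hf hcf hfc h1
  have hce : c * e = b * e * c := by
    calc c * e = c * (e * c * e⁻¹) * (e * c⁻¹) := by group
      _ = e * c⁻¹ := by rw [h1]; group
      _ = e * b⁻¹ * c := by rw [hb]; group
      _ = b * e * c := by rw [hz.inv_eq_mul hc, ← mul_assoc, hz.comm, mul_assoc z, hcf]
  have hfb : f * b = e * b * f := by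
    calc f * b = f * (b * f * b⁻¹) * (b * f⁻¹) := by group
      _ = b * f⁻¹ := by rw [h2]; group
      _ = b * e⁻¹ * f := by rw [he]; group
      _ = e * b * f := by rw [hz.inv_eq_mul hf, ← mul_assoc, hz.comm, mul_assoc z, hfc]
  have u1 : SemiconjBy (c * f) b e := by
    have hbeb : b * e * b = e := by
      rw [hcf, mul_assoc, mul_assoc, hc, hz.comm, ← mul_assoc, hz.mul_self, one_mul]
    calc c * f * b = c * e * b * f := by rw [mul_assoc, hfb]; group
      _ = b * e * (c * b) * f := by rw [hce]; group
      _ = (b * e * b) * (c * f) := by rw [← hbc]; group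
      _ = e * (c * f) := by rw [hbeb]
  have u2 : SemiconjBy (c * f) e (b * e) := by
    calc c * f * e = c * e * f := by rw [mul_assoc, ← hef, mul_assoc]
      _ = b * e * (c * f) := by rw [hce, mul_assoc]
  have u3 : SemiconjBy (c * f) (b * e) b := by
    have := u1.mul_right u2
    have hebe : e * (b * e) = b := by
      rw [← mul_assoc, hfc, mul_assoc, mul_assoc, hf, hz.comm, ← mul_assoc, hz.mul_self, one_mul]
    rwa [hebe] at this
  have u4 : Commute ((c * f) ^ 3) b := by
    have := u3.mul_left (u2.mul_left u1)
    rwa [show c * f * (c * f * (c * f)) = (c * f) ^ 3 by simp only [pow_succ, pow_zero, one_mul,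
      mul_assoc]] at this
  -- The order of cf is prime to 3, so cf is a power of its cube and commutes with b; this forces b
  -- = e.
  obtain ⟨k, hk⟩ := (IsPGroup.iff_orderOf.1 hG) (c * f)
  obtain ⟨m, hm⟩ := exists_pow_eq_self_of_coprime (n := 3) (x := c * f)
    (by rw [hk]; exact Nat.Coprime.pow_right k (by norm_num))
  have u5 : Commute (c * f) b := hm ▸ u4.pow_left m
  have hbe : b = e := mul_right_cancel (u5.eq.symm.trans u1.eq)
  rw [hbe] at hcf
  exact hz.mul_ne_self _ hcf.symm

/-- Some element of order four generates a normal subgroup. -/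
theorem exists_commute_or_anticommute (hz : IsUniqueInvolution z) (hG : IsPGroup 2 G)
    (h4 : ∃ b : G, b * b = z) :
    ∃ b : G, b * b = z ∧ ∀ g : G, Commute b g ∨ g * b = z * (b * g) := by
  by_cases h8 : ∃ c : G, (c * c) * (c * c) = z
  · obtain ⟨c, hc⟩ := h8
    refine ⟨c * c, hc, fun g => ?_⟩
    obtain ⟨f, hf⟩ : ∃ f, f = g * c * g⁻¹ := ⟨_, rfl⟩
    have hff : f * f = g * (c * c) * g⁻¹ := by rw [hf]; group
    have hf4 : (f * f) * (f * f) = z := by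
      calc (f * f) * (f * f) = g * ((c * c) * (c * c)) * g⁻¹ := by rw [hff]; group
        _ = z := by rw [hc, hz.comm, mul_inv_cancel_right]
    have hg : g * (c * c) = (f * f) * g := by rw [hff, inv_mul_cancel_right]
    obtain ⟨d, hd⟩ : ∃ d, d = (c * c) * (f * f) := ⟨_, rfl⟩
    have hdinv : (c * c) * d * (c * c)⁻¹ = d⁻¹ := by
      calc (c * c) * d * (c * c)⁻¹ = ((c * c) * (c * c)) * (f * f) * (c * c)⁻¹ := by rw [hd]; group
        _ = (f * f)⁻¹ * (c * c)⁻¹ := by rw [hc, hz.inv_eq_mul hf4]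
        _ = d⁻¹ := by rw [hd, mul_inv_rev (c * c)]
    have hfd : f * f = z * (c * c) * d := by
      rw [hd, ← hz.inv_eq_mul hc, inv_mul_cancel_left]
    -- d compares c² with its conjugate f²: d = 1 means f² = zc², and d = z means f² = c². Any other
    -- d has a power of order four, which c² inverts.
    by_cases h1 : d = 1
    · right
      rw [hg, hfd, h1, mul_one, mul_assoc]
    by_cases h2 : d = z
    · left
      rw [h2, hz.comm, ← mul_assoc, hz.mul_self, one_mul] at hfd
      rw [hfd] at hg
      exact hg.symm
    exfalso
    obtain ⟨k, hk⟩ := hz.exists_pow_mul_self_eq hG h1 h2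
    have hanti : (c * c) * d ^ 2 ^ k = z * (d ^ 2 ^ k * (c * c)) := by
      rw [← mul_assoc, ← hz.inv_eq_mul hk, ← inv_pow, ← hdinv, conj_pow, inv_mul_cancel_right]
    -- If the power is d itself, c² anticommutes with f²; otherwise it anticommutes with a square of
    -- an element of order eight. Both are excluded.
    cases k with
    | zero =>
      rw [pow_zero, pow_one, hd] at hanti
      refine hz.not_anticommute_mul_self hG hc hf4 (mul_left_cancel (a := c * c) ?_)
      rw [hanti, ← mul_assoc (c * c) z, hz.comm]
      group
    | succ k =>
      have : d ^ 2 ^ (k + 1) = d ^ 2 ^ k * d ^ 2 ^ k := by rw [pow_succ, pow_mul, pow_two]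
      rw [this] at hk hanti
      exact hz.not_anticommute_mul_self hG hc hk hanti
  · obtain ⟨b, hb⟩ := h4
    have hsq : ∀ g : G, g * g = 1 ∨ g * g = z := fun g => by
      by_contra! h
      obtain ⟨k, hk⟩ := hz.exists_pow_mul_self_eq hG h.1 h.2
      rw [(Commute.refl g).mul_pow] at hk
      exact h8 ⟨_, hk⟩
    refine ⟨b, hb, fun g => ?_⟩
    rcases hsq g with hg | hg
    · left
      rcases hz.eq_or_eq g hg with rfl | rfl
      · exact Commute.one_right b
      · exact hz.comm b
    have hgb : g * b = (b * g) * (b * g) * (b * g) := by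
      have : g * b = b⁻¹ * ((b * g) * (b * g)) * g⁻¹ := by group
      rw [this, hz.inv_eq_mul hb, hz.inv_eq_mul hg]
      rcases hsq (b * g) with h | h <;> rw [h]
      · rw [mul_one, one_mul, mul_assoc, ← mul_assoc b, hz.comm, mul_assoc z, ← mul_assoc z,
          hz.mul_self, one_mul]
      · rw [hz.comm, ← mul_assoc z, hz.mul_self, one_mul, ← mul_assoc, hz.comm, mul_assoc]
    rcases hsq (b * g) with h | h <;> rw [h] at hgb
    · left
      rw [one_mul] at hgb
      exact hgb.symm
    · exact Or.inr hgb

/-- An element that anticommutes with an element of order four has square `z`. -/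
theorem mul_self_eq_of_not_commute (hz : IsUniqueInvolution z) (hG : IsPGroup 2 G) {b y : G}
    (hb : b * b = z) (hy : ¬ Commute b y) (hanti : y * b = z * (b * y)) : y * y = z := by
  have hyy : Commute b (y * y) := by
    have : (y * y) * b = b * (y * y) := by
      rw [mul_assoc, hanti, ← mul_assoc, hz.comm, mul_assoc, ← mul_assoc y, hanti]
      simp only [← mul_assoc]
      rw [hz.mul_self, one_mul]
    exact this.symm
  by_contra h2
  have h1 : y * y ≠ 1 := fun h => by
    rcases hz.eq_or_eq y h with rfl | rfl
    · exact hy (Commute.one_right b)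
    · exact hy (hz.comm b)
  -- This power of y² commutes with b, so it is b or zb; yet it commutes with y.
  obtain ⟨k, hk⟩ := hz.exists_pow_mul_self_eq hG h1 h2
  have hyw : Commute ((y * y) ^ 2 ^ k) y :=
    ((Commute.refl y).mul_left (Commute.refl y)).pow_left _
  rcases hz.eq_or_eq_of_commute hb hk (hyy.pow_right _) with h | h <;> rw [h] at hyw
  · exact hy hyw
  · refine hy ?_
    have hzy : Commute z y := (hz.comm y).symm
    have := hzy.mul_left hyw
    rwa [← mul_assoc, hz.mul_self, one_mul] at this

end IsUniqueInvolution

/-! ### Characters and 2-power roots of unity -/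

/-- The character `q ↦ exp (2πiq)` of `ℚ / ℤ`. -/
noncomputable def ratCircleExp : AddCircle (1 : ℚ) →+ Additive ℂˣ :=
  QuotientAddGroup.lift (AddSubgroup.zmultiples (1 : ℚ))
    { toFun := fun q => Additive.ofMul
        (Units.mk0 (Complex.exp (2 * Real.pi * Complex.I * q)) (Complex.exp_ne_zero _))
      map_zero' := by
        rw [ofMul_eq_zero]
        ext
        simp
      map_add' := fun p q => by
        rw [← ofMul_mul]
        congr 1
        ext
        simp [mul_add, Complex.exp_add] }
    (by
      rintro _ ⟨n, rfl⟩
      rw [AddMonoidHom.mem_ker]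
      change Additive.ofMul _ = 0
      rw [ofMul_eq_zero]
      ext
      simp only [Units.val_mk0, Units.val_one, Complex.exp_eq_one_iff]
      exact ⟨n, by push_cast [zsmul_eq_mul]; ring⟩)

theorem ratCircleExp_injective : Function.Injective ratCircleExp := by
  refine (injective_iff_map_eq_zero _).2 fun x => ?_
  induction x using QuotientAddGroup.induction_on with
  | H q =>
    intro h
    change Additive.ofMul (Units.mk0 (Complex.exp (2 * Real.pi * Complex.I * q))
      (Complex.exp_ne_zero _)) = 0 at h
    have h := congrArg Units.val (ofMul_eq_zero.1 h)
    simp only [Units.val_mk0, Units.val_one, Complex.exp_eq_one_iff] at h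
    obtain ⟨n, hn⟩ := h
    have hq : (q : ℂ) = n := by
      refine mul_left_cancel₀ Complex.two_pi_I_ne_zero (hn.trans (mul_comm _ _))
    have hq : q = n := by exact_mod_cast hq
    refine (QuotientAddGroup.eq_zero_iff q).2 ⟨n, ?_⟩
    simp [hq]

/-- Characters into ℚ/ℤ separate points, and the exponential embeds ℚ/ℤ in ℂˣ. -/
theorem exists_character_apply_ne_one {A : Type*} [CommGroup A] {a : A} (ha : a ≠ 1) :
    ∃ φ : A →* ℂˣ, φ a ≠ 1 := by
  obtain ⟨c, hc⟩ := CharacterModule.exists_character_apply_ne_zero_of_ne_zero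
    (A := Additive A) (a := Additive.ofMul a) (by simpa using ha)
  refine ⟨(MonoidHom.toAdditive (α := A) (β := ℂˣ)).symm (ratCircleExp.comp c), fun h => hc ?_⟩
  refine ratCircleExp_injective ?_
  rw [map_zero]
  exact h

/-- A homomorphism that does not kill the only involution is injective. -/
theorem IsUniqueInvolution.injective_of_map_ne_one {G M : Type*} [Group G] [Group M] {z : G}
    (hz : IsUniqueInvolution z) (hG : IsPGroup 2 G) (φ : G →* M) (h : φ z ≠ 1) :
    Function.Injective φ := by
  refine (injective_iff_map_eq_one φ).2 fun g hg => ?_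
  by_contra h1
  obtain ⟨k, hk⟩ := hz.exists_pow_eq hG h1
  exact h (by rw [← hk, map_pow, hg, one_pow])

theorem mem_quasicyclic {x : ℂˣ} : x ∈ quasicyclic ↔ ∃ k : ℕ, x ^ 2 ^ k = 1 := by
  rw [← SetLike.mem_coe, coe_quasicyclic, Set.mem_iUnion]
  constructor
  · rintro ⟨k, hk⟩
    exact ⟨k, hk⟩
  · rintro ⟨k, hk⟩
    exact ⟨k.succPNat, cyclicFin_mono (Nat.le_succ k) hk⟩

/-- If `cyclicFin (m + 1)` is the first one not inside S, an element of S of order 2^k with k > m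
would generate `cyclicFin k` and thus bring it in. -/
theorem exists_eq_C (S : Subgroup ℂˣ) (hS : ∀ x ∈ S, ∃ k : ℕ, x ^ 2 ^ k = 1) :
    ∃ n : ℕ∞, S = C n := by
  classical
  by_cases h : ∀ n, cyclicFin n ≤ S
  · refine ⟨⊤, le_antisymm (fun x hx => mem_quasicyclic.2 (hS x hx)) ?_⟩
    exact iSup_le fun n => h n
  push Not at h
  obtain ⟨m, hm⟩ : ∃ m, Nat.find h = m + 1 := Nat.exists_eq_succ_of_ne_zero fun h0 => by
    have := Nat.find_spec h
    rw [h0] at this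
    refine this fun x hx => ?_
    have hx : x ^ 2 ^ 0 = 1 := hx
    rw [pow_zero, pow_one] at hx
    exact hx ▸ one_mem S
  have h1 : ¬ cyclicFin (m + 1) ≤ S := hm ▸ Nat.find_spec h
  have h2 : cyclicFin m ≤ S := not_not.1 (Nat.find_min h (by omega))
  refine ⟨m, le_antisymm (fun x hx => ?_) h2⟩
  obtain ⟨k, hk⟩ := (Nat.dvd_prime_pow Nat.prime_two).1
    (orderOf_dvd_of_pow_eq_one (hS x hx).choose_spec)
  rcases le_or_gt k m with hkm | hkm
  · refine cyclicFin_mono hkm ?_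
    change x ^ 2 ^ k = 1
    rw [← hk.2, pow_orderOf_eq_one]
  · refine absurd ?_ h1
    refine (cyclicFin_mono hkm).trans ?_
    have hp : IsPrimitiveRoot x (2 ^ k) := hk.2 ▸ IsPrimitiveRoot.orderOf x
    rw [cyclicFin, ← hp.zpowers_eq]
    exact Subgroup.zpowers_le.2 hx

theorem infinite_C_iff {n : ℕ∞} : Infinite (C n) ↔ n = ⊤ := by
  constructor
  · intro h
    by_contra hn
    lift n to ℕ using hn
    have : Finite (cyclicFin n) := inferInstanceAs (Finite (rootsOfUnity (2 ^ n) ℂ))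
    exact h.not_finite this
  · rintro rfl
    by_contra h
    rw [not_infinite_iff_finite] at h
    have hle : ∀ n : ℕ, 2 ^ n ≤ Nat.card (C ⊤) := fun n => by
      rw [← Complex.card_rootsOfUnity (2 ^ n)]
      exact Subgroup.card_le_of_le fun x hx => mem_quasicyclic.2 ⟨n, hx⟩
    exact (hle (Nat.card (C ⊤))).not_gt Nat.lt_two_pow_self

/-! ### Generators of the quaternion groups -/

theorem Q_add_one (n : ℕ∞) :
    Q (n + 1) = Subgroup.closure (complexUnits '' (C n : Set ℂˣ) ∪ Q8) := by
  induction n using ENat.recTopCoe with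
  | top =>
    rw [top_add, C_top, Q_top, coe_quasicyclic, quaternionInf, Set.image_iUnion, Set.iUnion_union,
      Subgroup.closure_iUnion]
    refine le_antisymm (iSup_le fun n => ?_) (iSup_le fun n => ?_)
    · exact le_iSup_of_le n (Subgroup.closure_mono (Set.union_subset_union_left _
        (Set.image_mono (cyclicFin_mono (Nat.sub_le _ _)))))
    · exact le_iSup_of_le (n + 1) (Subgroup.closure_mono (Set.union_subset_union_left _
        (Set.image_mono (cyclicFin_mono (by simp)))))
  | coe n => exact Q_coe (n + 1)

/-- The quaternion `j` as a unit. -/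
def unitJ : ℍ[ℝ]ˣ where
  val := qj
  inv := -qj
  val_inv := by ext <;> simp <;> simp [qj]
  inv_val := by ext <;> simp <;> simp [qj]

theorem complexUnits_injective : Function.Injective complexUnits := by
  refine Units.map_injective ?_
  intro z w h
  have h : (Quaternion.coeComplex z) = Quaternion.coeComplex w := h
  exact Complex.ext (congrArg QuaternionAlgebra.re h) (congrArg QuaternionAlgebra.imI h)

theorem val_complexUnits (w : ℂˣ) : (complexUnits w : ℍ[ℝ]) = ⟨(w : ℂ).re, (w : ℂ).im, 0, 0⟩ := rfl

theorem val_unitJ : (unitJ : ℍ[ℝ]) = qj := rfl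

theorem unitJ_mul_self : unitJ * unitJ = complexUnits (-1) := by
  ext <;> simp [val_unitJ] <;> simp [qj, val_complexUnits]

/-- Roots of unity have norm 1, so inversion is complex conjugation, which is what conjugation by j
induces on ℂ. -/
theorem complexUnits_mul_unitJ {w : ℂˣ} {k : ℕ} (hw : w ^ 2 ^ k = 1) :
    complexUnits w * unitJ = unitJ * complexUnits w⁻¹ := by
  have h1 : ‖(w : ℂ)‖ = 1 :=
    Complex.norm_eq_one_of_pow_eq_one (n := 2 ^ k)
      (by rw [← Units.val_pow_eq_pow_val, hw, Units.val_one])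
      (by positivity)
  have h2 : ((w⁻¹ : ℂˣ) : ℂ) = (starRingEnd ℂ) w := by
    rw [Units.val_inv_eq_inv_val, Complex.inv_eq_conj h1]
  obtain ⟨v, hv⟩ : ∃ v, v = w⁻¹ := ⟨_, rfl⟩
  rw [← hv] at h2 ⊢
  ext <;> simp [val_unitJ] <;> simp [qj, val_complexUnits, h2]

/-- The hypothesis on w puts i in S, so j alone supplies the rest of Q₈. -/
theorem closure_complexUnits_union_unitJ {S : Subgroup ℂˣ} {w : ℂˣ} (hw : w ∈ S)
    (hw2 : w * w = -1) :
    Subgroup.closure (complexUnits '' (S : Set ℂˣ) ∪ {unitJ}) =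
      Subgroup.closure (complexUnits '' (S : Set ℂˣ) ∪ Q8) := by
  refine le_antisymm (Subgroup.closure_mono (Set.union_subset_union_right _ ?_)) ?_
  · rintro _ rfl
    simp [Q8, unitJ]
  rw [Subgroup.closure_le, Set.union_subset_iff]
  refine ⟨Set.subset_union_left.trans Subgroup.subset_closure, fun q hq => ?_⟩
  set K := Subgroup.closure (complexUnits '' (S : Set ℂˣ) ∪ {unitJ})
  have hS : ∀ v ∈ S, complexUnits v ∈ K := fun v hv =>
    Subgroup.subset_closure (Or.inl ⟨v, hv, rfl⟩)
  have hJ : unitJ ∈ K := Subgroup.subset_closure (Or.inr rfl)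
  have hneg : -1 ∈ S := hw2 ▸ mul_mem hw hw
  let I : ℂˣ := Units.mk0 Complex.I Complex.I_ne_zero
  have hI : I ∈ S := by
    have h : (w : ℂ) * w = Complex.I * Complex.I := by
      rw [Complex.I_mul_I]
      exact congrArg Units.val hw2
    rcases mul_self_eq_mul_self_iff.1 h with h | h
    · rwa [show I = w from Units.ext h.symm]
    · rw [show I = -1 * w from Units.ext (by simp [I, h])]
      exact mul_mem hneg hw
  have hnegI : -I ∈ S := by
    rw [← neg_one_mul]
    exact mul_mem hneg hI
  simp only [Q8, Set.mem_ofPred_eq, Set.mem_insert_iff, Set.mem_singleton_iff] at hq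
  rcases hq with h | h | h | h | h | h | h | h
  · rw [show q = 1 from Units.ext h]
    exact one_mem K
  · rw [show q = complexUnits (-1) by ext <;> simp [h, val_complexUnits]]
    exact hS _ hneg
  · rw [show q = complexUnits I by ext <;> simp [h] <;> simp [val_complexUnits, I, qi]]
    exact hS _ hI
  · rw [show q = complexUnits (-I) by ext <;> simp [h] <;> simp [val_complexUnits, I, qi]]
    exact hS _ hnegI
  · rw [show q = unitJ from Units.ext h]
    exact hJ
  · rw [show q = complexUnits (-1) * unitJ by
      ext <;> simp [h, val_unitJ] <;> simp [val_complexUnits, qj]]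
    exact mul_mem (hS _ hneg) hJ
  · rw [show q = complexUnits I * unitJ by
      ext <;> simp [h, val_unitJ] <;> simp [val_complexUnits, qj, qk, I]]
    exact mul_mem (hS _ hI) hJ
  · rw [show q = complexUnits (-I) * unitJ by
      ext <;> simp [h, val_unitJ] <;> simp [val_complexUnits, qj, qk, I]]
    exact mul_mem (hS _ hnegI) hJ

/-! ### The embedding and the classification -/

/-- An abelian 2-group with only one involution is isomorphic to some `C n`. -/
theorem IsUniqueInvolution.exists_range_eq_C {A : Type*} [Group A] {z : A}
    (hz : IsUniqueInvolution z) (hA : IsPGroup 2 A) (hcomm : ∀ g h : A, Commute g h) :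
    ∃ (n : ℕ∞) (φ : A →* ℂˣ), Function.Injective φ ∧ φ.range = C n := by
  let _ : CommGroup A := { ‹Group A› with mul_comm := fun g h => (hcomm g h).eq }
  obtain ⟨φ, hφ⟩ := exists_character_apply_ne_one hz.ne_one
  obtain ⟨n, hn⟩ := exists_eq_C φ.range (by
    rintro _ ⟨g, rfl⟩
    obtain ⟨k, hk⟩ := hA g
    exact ⟨k, by rw [← map_pow, hk, map_one]⟩)
  exact ⟨n, φ, hz.injective_of_map_ne_one hA φ hφ, hn⟩

theorem infinite_iff_of_range_eq_C {A : Type*} [Group A] {n : ℕ∞} {φ : A →* ℂˣ}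
    (hφ : Function.Injective φ) (hn : φ.range = C n) : n = ⊤ ↔ Infinite A := by
  rw [← infinite_C_iff, ← hn]
  exact (MonoidHom.ofInjective hφ).toEquiv.infinite_iff.symm

/-- A homomorphism on a subgroup `K` of index two extends to the whole group once a compatible
image `j` of an element `y ∉ K` that inverts `K` is chosen. -/
theorem exists_extension_of_inverts {G M : Type*} [Group G] [Group M] {K : Subgroup G} {y : G}
    (hy : y ∉ K) (hK : ∀ g ∉ K, y⁻¹ * g ∈ K) (hyy : y * y ∈ K)
    (hinv : ∀ k ∈ K, k * y = y * k⁻¹) (ψ : K →* M) (j : M) (hj : j * j = ψ ⟨y * y, hyy⟩)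
    (hψj : ∀ k : K, ψ k * j = j * (ψ k)⁻¹) :
    ∃ Φ : G →* M, (∀ k : K, Φ k = ψ k) ∧ Φ y = j := by
  classical
  let f : G → M := fun g =>
    if h : g ∈ K then ψ ⟨g, h⟩ else j * ψ ⟨y⁻¹ * g, hK g h⟩
  have hf1 : ∀ k : K, f k = ψ k := fun k => by simp [f]
  have hf2 : ∀ k : K, f (y * k) = j * ψ k := fun k => by
    have hyk : y * (k : G) ∉ K := fun h => hy ((Subgroup.mul_mem_cancel_right K k.2).1 h)
    simp [f, hyk]
  have hcases : ∀ g : G, ∃ k : K, g = k ∨ g = y * k := fun g => by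
    by_cases h : g ∈ K
    · exact ⟨⟨g, h⟩, Or.inl rfl⟩
    · exact ⟨⟨_, hK g h⟩, Or.inr (mul_inv_cancel_left y g).symm⟩
  refine ⟨MonoidHom.mk' f fun g h => ?_, hf1, ?_⟩
  · obtain ⟨k, rfl | rfl⟩ := hcases g <;> obtain ⟨l, rfl | rfl⟩ := hcases h
    · rw [hf1, hf1, ← Subgroup.coe_mul, hf1, map_mul]
    · have : (k : G) * (y * l) = y * ((k⁻¹ * l : K) : G) := by
        rw [← mul_assoc, hinv k k.2, mul_assoc]; rfl
      rw [this, hf1, hf2, hf2, ← mul_assoc, hψj, map_mul, map_inv, mul_assoc]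
    · rw [hf1, hf2, mul_assoc, ← Subgroup.coe_mul, hf2, map_mul, mul_assoc]
    · have : y * (k : G) * (y * l) = ((⟨y * y, hyy⟩ * (k⁻¹ * l) : K) : G) := by
        rw [mul_assoc, ← mul_assoc (k : G), hinv k k.2]
        simp only [Subgroup.coe_mul, Subgroup.coe_inv, mul_assoc]
      rw [this, hf1, hf2, hf2, map_mul, map_mul, map_inv, ← hj, mul_assoc j (ψ k),
        ← mul_assoc (ψ k), hψj]
      simp only [mul_assoc]
  · have := hf2 1
    rwa [Subgroup.coe_one, mul_one, map_one, mul_one] at this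

end TwoGroups

open TwoGroups in
theorem theorem1 {G : Type*} [Group G] (hG : IsPGroup 2 G)
    (hU : ∃! H : Subgroup G, Nat.card H = 2) :
    ∃ n : ℕ∞, 1 ≤ n ∧ (n = ⊤ ↔ Infinite G) ∧
      (Nonempty (G ≃* TwoGroups.C n) ∨ Nonempty (G ≃* TwoGroups.Q n)) := by
  obtain ⟨z, hz⟩ := exists_isUniqueInvolution hU
  by_cases hcomm : ∀ g h : G, Commute g h
  · obtain ⟨n, φ, hφ, hn⟩ := hz.exists_range_eq_C hG hcomm
    refine ⟨n, ?_, infinite_iff_of_range_eq_C hφ hn,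
      Or.inl ⟨(MonoidHom.ofInjective hφ).trans (MulEquiv.subgroupCongr hn)⟩⟩
    rw [Order.one_le_iff_ne_zero]
    rintro rfl
    have hmem : φ z ^ 2 ^ 0 = 1 := (hn ▸ ⟨z, rfl⟩ : φ z ∈ C (0 : ℕ))
    rw [pow_zero, pow_one] at hmem
    exact hz.ne_one (hφ (hmem.trans (map_one φ).symm))
  have h4 : ∃ b : G, b * b = z := by
    by_contra h4
    have hg : ∀ g : G, g = 1 ∨ g = z := fun g => by
      by_contra! h
      obtain ⟨k, hk⟩ := hz.exists_pow_mul_self_eq hG h.1 h.2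
      exact h4 ⟨_, hk⟩
    refine hcomm fun g h => ?_
    rcases hg h with rfl | rfl
    · exact Commute.one_right g
    · exact hz.comm g
  obtain ⟨b, hb, hbG⟩ := hz.exists_commute_or_anticommute hG h4
  obtain ⟨y, hby⟩ : ∃ y, ¬ Commute b y := by
    by_contra! h
    exact hcomm fun g g' => hz.commute_of_commute hG hb (h g) (h g')
  let K : Subgroup G := Subgroup.centralizer {b}
  have hKmem : ∀ g, g ∈ K ↔ Commute b g := fun g => Subgroup.mem_centralizer_singleton_iff.trans
    ⟨fun h => Eq.symm h, fun h => Eq.symm h⟩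
  have hsq : ∀ g ∉ K, g * g = z := fun g hg => by
    rw [hKmem] at hg
    exact hz.mul_self_eq_of_not_commute hG hb hg ((hbG g).resolve_left hg)
  have hyK : y ∉ K := fun h => hby ((hKmem y).1 h)
  have hyy : y * y = z := hsq y hyK
  have hzK : z ∈ K := (hKmem z).2 (hz.comm b)
  -- Both y and yk lie outside K, so (yk)² = z = y²; cancelling y leaves kyk = y.
  have hinv : ∀ k ∈ K, k * y = y * k⁻¹ := fun k hk => by
    have h1 := hsq (y * k) fun h => hyK ((Subgroup.mul_mem_cancel_right K hk).1 h)
    rw [← hyy, mul_assoc] at h1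
    rw [eq_mul_inv_iff_mul_eq, mul_assoc]
    exact mul_left_cancel h1
  -- Both y and g anticommute with b, so the two factors z cancel: K has index two.
  have hK : ∀ g ∉ K, y⁻¹ * g ∈ K := fun g hg => by
    have h1 := (hbG g).resolve_left fun h => hg ((hKmem g).2 h)
    have h2 := (hbG y).resolve_left hby
    rw [hKmem]
    have h3 : b * y⁻¹ = z * (y⁻¹ * b) := by
      rw [mul_inv_eq_iff_eq_mul]
      calc b = y⁻¹ * (y * b) := by group
        _ = y⁻¹ * z * (b * y) := by rw [h2]; group
        _ = z * (y⁻¹ * b) * y := by rw [hz.comm]; group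
    calc b * (y⁻¹ * g) = z * (y⁻¹ * b) * g := by rw [← mul_assoc, h3]
      _ = z * y⁻¹ * (b * g) := by group
      _ = y⁻¹ * (z * (b * g)) := by rw [← hz.comm]; group
      _ = y⁻¹ * g * b := by rw [← h1, mul_assoc]
  have hzK' : IsUniqueInvolution (⟨z, hzK⟩ : K) :=
    ⟨fun h => hz.ne_one (congrArg Subtype.val h), Subtype.ext hz.mul_self, fun k hk =>
      (hz.eq_or_eq k (congrArg Subtype.val hk)).imp Subtype.ext Subtype.ext⟩
  have hGK : IsPGroup 2 K := hG.to_subgroup K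
  obtain ⟨n, φ, hφ, hn⟩ := hzK'.exists_range_eq_C hGK fun g h => Subtype.ext
    (hz.commute_of_commute hG hb ((hKmem _).1 g.2) ((hKmem _).1 h.2)).eq
  have hφz : φ ⟨z, hzK⟩ = -1 := by
    have h1 : (φ ⟨z, hzK⟩ : ℂ) * φ ⟨z, hzK⟩ = 1 := by
      rw [← Units.val_mul, ← map_mul, hzK'.mul_self, map_one, Units.val_one]
    rcases mul_self_eq_one_iff.1 h1 with h | h
    · exact absurd (hφ ((Units.ext h).trans (map_one φ).symm)) hzK'.ne_one
    · exact Units.ext h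
  have hyyK : y * y ∈ K := hyy ▸ hzK
  obtain ⟨Φ, hΦK, hΦy⟩ := exists_extension_of_inverts hyK hK hyyK hinv (complexUnits.comp φ) unitJ
    (by
      rw [unitJ_mul_self, MonoidHom.comp_apply, ← hφz]
      exact congrArg (fun k => complexUnits (φ k)) (Subtype.ext hyy.symm))
    (fun k => by
      obtain ⟨m, hm⟩ := hGK k
      rw [MonoidHom.comp_apply, ← map_inv]
      exact complexUnits_mul_unitJ (k := m) (by rw [← map_pow, hm, map_one]))
  have hΦ : Function.Injective Φ := by
    refine hz.injective_of_map_ne_one hG Φ fun h => ?_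
    have h := (hΦK ⟨z, hzK⟩).symm.trans (h.trans (map_one complexUnits).symm)
    exact hzK'.ne_one (hφ ((complexUnits_injective h).trans (map_one φ).symm))
  have hcases : ∀ g : G, ∃ k : K, g = k ∨ g = y * k := fun g => by
    by_cases h : g ∈ K
    · exact ⟨⟨g, h⟩, Or.inl rfl⟩
    · exact ⟨⟨_, hK g h⟩, Or.inr (mul_inv_cancel_left y g).symm⟩
  have hrange : Φ.range = Q (n + 1) := by
    have hbK : b ∈ K := (hKmem b).2 (Commute.refl b)
    rw [Q_add_one, ← closure_complexUnits_union_unitJ (w := φ ⟨b, hbK⟩) (hn ▸ ⟨_, rfl⟩)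
      (by rw [← map_mul, ← hφz]; exact congrArg φ (Subtype.ext hb))]
    apply le_antisymm
    · have hmem : ∀ k : K, Φ k ∈
          Subgroup.closure (complexUnits '' (C n : Set ℂˣ) ∪ {unitJ}) := fun k => by
        rw [hΦK]
        exact Subgroup.subset_closure (Or.inl ⟨φ k, hn ▸ ⟨k, rfl⟩, rfl⟩)
      rintro _ ⟨g, rfl⟩
      obtain ⟨k, rfl | rfl⟩ := hcases g
      · exact hmem k
      · rw [map_mul, hΦy]
        exact mul_mem (Subgroup.subset_closure (Or.inr rfl)) (hmem k)
    · rw [Subgroup.closure_le]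
      rintro _ (⟨w, hw, rfl⟩ | rfl)
      · rw [← hn] at hw
        obtain ⟨k, rfl⟩ := hw
        exact ⟨k, hΦK k⟩
      · exact ⟨y, hΦy⟩
  refine ⟨n + 1, le_add_self, ?_,
    Or.inr ⟨(MonoidHom.ofInjective hΦ).trans (MulEquiv.subgroupCongr hrange)⟩⟩
  have hn1 : n + 1 = ⊤ ↔ n = ⊤ := by simp
  rw [hn1, infinite_iff_of_range_eq_C hφ hn]
  -- G is covered by K and yK, so G is infinite exactly when K is.
  refine ⟨fun _ => Infinite.of_injective _ K.subtype_injective, fun h => ?_⟩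
  by_contra hfin
  rw [not_infinite_iff_finite] at hfin
  refine h.not_finite (Finite.of_surjective
    (Sum.elim (fun k : K => (k : G)) fun k : K => y * k) fun g => ?_)
  obtain ⟨k, h | h⟩ := hcases g
  · exact ⟨Sum.inl k, h.symm⟩
  · exact ⟨Sum.inr k, h.symm⟩
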